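/- **Setting.** Let $G$ be an infinite countable set, let $E=\mathbb N=\{0,1,2,\dots\}$ or $E=\{0,1,\dots,\alpha\}$ with $\alpha\ge 1$, let $\Omega=E^G$ be the space of configurations (with the product $\sigma$-algebra), $\Omega_f$ the countable set of $\xi\in\Omega$ with $|\xi|:=\sum_{x}\xi_x<\infty$, and $\Omega_n=\{\xi\in\Omega_f:|\xi|=n\}$. Let $\{\eta(t):t\ge0\}$ be a Markov process on a subset of $\Omega$, with semigroup $S(t)f(\eta)=\mathbb E_\eta f(\eta(t))$, and let the *dual process* $\{\xi(t):t\ge0\}$ be a Markov process on $\Omega_f$ which conserves the number of particles $|\xi|$. Assume that for all $t\ge 0$, all $\xi\in\Omega_f$ and all $\eta$ in the state space of $\eta(\cdot)$ $$\mathbb E_\eta D(\xi,\eta(t))=\widehat{\mathbb E}_\xi D(\xi(t),\eta),\qquad D(\xi,\eta)=\prod_{x\in G}d(\xi_x,\eta_x),$$ where $d(0,\cdot)=1$ and, for each $k\in E$, $d(k,\cdot)$ is a polynomial of degree $k$ that is non-negative on $E$. The $D$-transform of a probability measure $\mu$ on $\Omega$ for which all $D(\xi,\cdot)$ are integrable is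 $\widehat\mu(\xi)=\int D(\xi,\eta)\,d\mu(\eta)$, $\xi\in\Omega_f$. Such a $\mu$ is *tempered* if (i) $\sup_{|\xi|\le n}\widehat\mu(\xi)<\infty$ for all $n$; (ii) $\mu$ is determined by its $D$-transform among the probability measures on $\Omega$ for which all $D(\xi,\cdot)$ are integrable; (iii) the linear span of $\{D(\xi,\cdot):\xi\in\Omega_f\}$ is dense in $L^2(\mu)$. An invariant probability measure $\mu$ of $\{\eta(t)\}$ is *ergodic* if every $f\in L^2(\mu)$ with $S(t)f=f$ $\mu$-a.s. for all $t\ge 0$ satisfies $f=\int f\,d\mu$ $\mu$-a.s. The dual process *admits a successful coupling* if for all $n$ and all $\xi,\xi'\in\Omega_n$ there is a coupling $\{(\xi^{(1)}(t),\xi^{(2)}(t)):t\ge0\}$ of the dual processes started from $\xi$ and $\xi'$ such that $\inf\{T>0:\xi^{(1)}(t)=\xi^{(2)}(t)\ \forall t\ge T\}$ is almost surely finite. It *spreads out* if for all $\xi,\xi'\in\Omega_f$ the probability $\widehat{\mathbb P}_\xi(\xi(t)\text{ and }\xi'\text{ have disjoint supports})$ tends to $1$ as $t\to\infty$. **Theorem.**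 Assume that the dual process admits a successful coupling, and let $\mu$ be a tempered invariant probability measure of $\{\eta(t)\}$. 1. There is a function $f:\mathbb N\to[0,\infty)$ such that $\widehat\mu(\xi)=f(n)$ for all $n\in\mathbb N$ and all $\xi\in\Omega_n$. 2. If moreover $\mu$ is ergodic and the dual process spreads out, then $f(n)=f(1)^n$ for all $n$, and $\mu$ is a product measure, $\mu=\bigotimes_{x\in G}\mu_x$. -/

import Mathlib

open MeasureTheory ProbabilityTheory Filter Topology
open scoped NNReal ENNReal Polynomial

universe u v

namespace ParticleDuality

/-! ### Configurations -/

/-- Configurations `η ∈ ℕ^G` with at most `cap` particles per site: `cap = ⊤` gives all of `ℕ^G`,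
and `cap = α` finite gives the exclusion-type space `{0, …, α}^G`. -/
def configSpace (G : Type u) (cap : ℕ∞) : Set (G → ℕ) :=
  {η | ∀ x, (η x : ℕ∞) ≤ cap}

/-- Finite configurations (finitely many particles, at most `cap` per site). -/
def FinConfig (G : Type u) (cap : ℕ∞) : Type u :=
  {ξ : G →₀ ℕ // ∀ x, (ξ x : ℕ∞) ≤ cap}

/-- The (countable) set of finite configurations carries the discrete σ-algebra. -/
instance (G : Type u) (cap : ℕ∞) : MeasurableSpace (FinConfig G cap) := ⊤

/-- The number of particles `|ξ| = ∑ x, ξ x`. -/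
noncomputable def FinConfig.size {G : Type u} {cap : ℕ∞} (ξ : FinConfig G cap) : ℕ := ξ.1.degree

/-- `ξ ⊥ ξ'`: the supports of the two configurations are disjoint. -/
def FinConfig.Perp {G : Type u} {cap : ℕ∞} (ξ ξ' : FinConfig G cap) : Prop :=
  Disjoint ξ.1.support ξ'.1.support

/-! ### Markov processes -/

/-- The transition semigroup of a (conservative, time-homogeneous) Markov process on `S`:
`kernel t x` is the law at time `t` of the process started from `x`. -/
structure MarkovSemigroup (S : Type u) [MeasurableSpace S] where
  kernel : ℝ≥0 → Kernel S S
  isMarkovKernel : ∀ t, IsMarkovKernel (kernel t)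
  zero : kernel 0 = Kernel.id
  add : ∀ s t, kernel (s + t) = (kernel t).comp (kernel s)

/-- `μ` is a (probability) measure that is invariant under the process. -/
def MarkovSemigroup.IsInvariant {S : Type u} [MeasurableSpace S] (P : MarkovSemigroup S)
    (μ : Measure S) : Prop :=
  IsProbabilityMeasure μ ∧ ∀ t, μ.bind (P.kernel t) = μ

/-- An invariant probability measure `μ` is ergodic if every `f ∈ L²(μ)` such that, for all `t`,
`S(t) f = f` holds `μ`-a.s. is `μ`-a.s. equal to the constant `∫ f dμ`. -/
def MarkovSemigroup.IsErgodic {S : Type u} [MeasurableSpace S] (P : MarkovSemigroup S)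
    (μ : Measure S) : Prop :=
  P.IsInvariant μ ∧
    ∀ f : S → ℝ, MemLp f 2 μ → (∀ t, (fun x => ∫ y, f y ∂(P.kernel t x)) =ᵐ[μ] f) →
      f =ᵐ[μ] fun _ => ∫ y, f y ∂μ

/-- `Y` is, under `Pr`, a Markov process with transition semigroup `P` started from `x`. -/
structure IsMarkovProcess {S : Type u} [MeasurableSpace S] (P : MarkovSemigroup S)
    {W : Type v} [MeasurableSpace W] (Pr : Measure W) (Y : ℝ≥0 → W → S) (x : S) : Prop where
  measurable : ∀ t, Measurable (Y t)
  init : ∀ᵐ w ∂Pr, Y 0 w = x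
  markov : ∀ (s t : ℝ≥0) (A : Set S), MeasurableSet A →
    condExp (⨆ r : ℝ≥0, ⨆ _ : r ≤ s, MeasurableSpace.comap (Y r) inferInstance) Pr
        ((Y (s + t) ⁻¹' A).indicator fun _ => (1 : ℝ))
      =ᵐ[Pr] fun w => (P.kernel t (Y s w)).real A

/-- The coupling time `inf {T > 0 : Y t = Y' t for all t ≥ T}`, equal to `∞` if there is no such
`T`. -/
noncomputable def couplingTime {S : Type u} {W : Type v} (Y Y' : ℝ≥0 → W → S) (w : W) : ℝ≥0∞ :=
  sInf ((fun T : ℝ≥0 => (T : ℝ≥0∞)) '' {T | 0 < T ∧ ∀ t, T ≤ t → Y t w = Y' t w})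

/-! ### Assumptions on the dual process -/

section Dual

variable {G : Type u} {cap : ℕ∞} (Q : MarkovSemigroup (FinConfig G cap))

/-- The number of particles is almost surely conserved. -/
def ConservesParticles : Prop :=
  ∀ t ξ, ∀ᵐ ζ ∂(Q.kernel t ξ), ζ.size = ξ.size

/-- Successful coupling: any two initial configurations with the same number of particles admit
a coupling of the two processes whose coupling time is almost surely finite. -/
def HasSuccessfulCoupling : Prop :=
  ∀ ξ ξ' : FinConfig G cap, ξ.size = ξ'.size →
    ∃ (W : Type v) (_ : MeasurableSpace W) (Pr : Measure W) (_ : IsProbabilityMeasure Pr)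
      (Y Y' : ℝ≥0 → W → FinConfig G cap),
      IsMarkovProcess Q Pr Y ξ ∧ IsMarkovProcess Q Pr Y' ξ' ∧
        ∀ᵐ w ∂Pr, couplingTime Y Y' w < ∞

/-- The process spreads out: for all `ξ, ξ'`, the probability, starting from `ξ`, that
`ξ(t) ⊥ ξ'` tends to `1` as `t → ∞`. -/
def SpreadsOut : Prop :=
  ∀ ξ ξ' : FinConfig G cap,
    Tendsto (fun t : ℝ≥0 => Q.kernel t ξ {ζ | ζ.Perp ξ'}) atTop (𝓝 1)

end Dual

/-! ### Factorized duality polynomials -/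

/-- The single-site duality polynomials `d(k, ·)`, for admissible occupation numbers `k ≤ cap`:
`d(0, ·) = 1`, and `d(k, ·)` has degree (exactly) `k` and is non-negative on occupation numbers.
In particular every polynomial of degree `k` is a linear combination of `d(0, ·), …, d(k, ·)`. -/
structure IsDualityPolynomials (cap : ℕ∞) (d : ℕ → ℝ[X]) : Prop where
  zero : d 0 = 1
  natDegree : ∀ k : ℕ, (k : ℕ∞) ≤ cap → (d k).natDegree = k
  nonneg : ∀ k n : ℕ, (k : ℕ∞) ≤ cap → (n : ℕ∞) ≤ cap → 0 ≤ (d k).eval (n : ℝ)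

section Transform

variable {G : Type u} {cap : ℕ∞} (d : ℕ → ℝ[X])

/-- The factorized duality function `D(ξ, η) = ∏ x, d(ξ x, η x)`; the sites with `ξ x = 0`
contribute the factor `d(0, η x) = 1`. -/
noncomputable def dualityFun (ξ : FinConfig G cap) (η : G → ℕ) : ℝ :=
  ξ.1.prod fun x k => (d k).eval (η x : ℝ)

/-- The duality relation `E_η D(ξ, η(t)) = Ê_ξ D(ξ(t), η)` between a process on `E ⊆ ℕ^G` and a
process of finite configurations, as an identity of (expectations of non-negative functions)
in `[0, ∞]`. -/
def IsDual {E : Set (G → ℕ)} (P : MarkovSemigroup E) (Q : MarkovSemigroup (FinConfig G cap)) :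
    Prop :=
  ∀ (t : ℝ≥0) (ξ : FinConfig G cap) (η : E),
    ∫⁻ η', ENNReal.ofReal (dualityFun d ξ (η' : G → ℕ)) ∂(P.kernel t η) =
      ∫⁻ ξ', ENNReal.ofReal (dualityFun d ξ' (η : G → ℕ)) ∂(Q.kernel t ξ)

/-- The `D`-transform of `m`: `m̂(ξ) = ∫ D(ξ, η) dm(η)`. -/
noncomputable def dTransform (m : Measure (G → ℕ)) (ξ : FinConfig G cap) : ℝ :=
  ∫ η, dualityFun d ξ η ∂m

/-- Tempered probability measures on the configuration space. -/
structure IsTempered (cap : ℕ∞) (m : Measure (G → ℕ)) : Prop where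
  isProbabilityMeasure : IsProbabilityMeasure m
  ae_mem : ∀ᵐ η ∂m, η ∈ configSpace G cap
  integrable : ∀ ξ : FinConfig G cap, Integrable (dualityFun d ξ) m
  bounded : ∀ n : ℕ, BddAbove {c | ∃ ξ : FinConfig G cap, ξ.size ≤ n ∧ c = dTransform d m ξ}
  determined : ∀ m' : Measure (G → ℕ), IsProbabilityMeasure m' →
    (∀ᵐ η ∂m', η ∈ configSpace G cap) →
    (∀ ξ : FinConfig G cap, Integrable (dualityFun d ξ) m') →
    (∀ ξ : FinConfig G cap, dTransform d m ξ = dTransform d m' ξ) → m = m'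
  dense : Dense {g : Lp ℝ 2 m | ∃ h ∈ Submodule.span ℝ
    (Set.range fun ξ : FinConfig G cap => dualityFun d ξ), (g : (G → ℕ) → ℝ) =ᵐ[m] h}

end Transform

/-- `m` is a product (over the sites) of probability measures on `ℕ`. -/
def IsProductMeasure {G : Type u} (m : Measure (G → ℕ)) : Prop :=
  ∃ p : G → ProbabilityMeasure ℕ, m = Measure.infinitePi fun x => (p x : Measure ℕ)

end ParticleDuality

open ParticleDuality

/-! Duality and invariance make the `D`-transform of `μ` harmonic for the dual process
(`IsDual.lintegral_dTransform`). On each particle-number level it is bounded by temperedness, and a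
successful coupling forces bounded harmonic functions there to be constant; this gives `f`.

For the second part, the process acts on `L²(μ)` by contractions `S(t)`, and `D(ξ, ·)` lies in
`L²(μ)` with norm controlled by `|ξ|`. By duality `⟨S(t) D(ξ, ·), D(ξ', ·)⟩` averages `∫ D(ζ, ·)
D(ξ', ·) dμ` over the law of `ζ = ξ(t)`. Once `ζ` and `ξ'` have disjoint supports the integrand is
`D(ζ + ξ', ·)`, so the limit is `f (|ξ| + |ξ'|)` (`tendsto_inner_transitionOp_dualityLp`). Since the
span of the `D(ξ', ·)` is dense, a weak limit of `S(t) D(ξ, ·)` is invariant, hence constant by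
ergodicity. Reading the limit against `D(ξ', ·)` gives `f (|ξ| + |ξ'|) = f |ξ| * f |ξ'|`. Finally
`μ` and the product of its marginals have the same `D`-transform, so they coincide. -/

namespace ParticleDuality

/-! ### Duality polynomials, finite configurations and second moments. -/

section DualityFunctions

variable {G : Type u} {cap : ℕ∞} {d : ℕ → ℝ[X]}

instance [Countable G] : Countable (FinConfig G cap) :=
  inferInstanceAs (Countable {ξ : G →₀ ℕ // ∀ x, (ξ x : ℕ∞) ≤ cap})

instance : DiscreteMeasurableSpace (FinConfig G cap) := ⟨fun _ => trivial⟩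

/-- With unbounded occupation, `d (2 * k)` has at least the degree of `d k ^ 2`, so it dominates at
infinity and the constant absorbs the finitely many remaining values. With finite `cap` only
finitely many values occur, and `e = 0` suffices (`2 * k` might not be admissible). -/
theorem IsDualityPolynomials.exists_sq_eval_le (hd : IsDualityPolynomials cap d) (k : ℕ)
    (hk : (k : ℕ∞) ≤ cap) :
    ∃ C : ℝ, 1 ≤ C ∧ ∃ e : ℕ, e ≤ 2 * k ∧ (e : ℕ∞) ≤ cap ∧ ∀ n : ℕ, (n : ℕ∞) ≤ cap →
      (d k).eval (n : ℝ) ^ 2 ≤ C * (1 + (d e).eval (n : ℝ)) := by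
  induction cap using ENat.recTopCoe with
  | top =>
    have hO : (fun x : ℝ => (d k ^ 2).eval x) =O[atTop] fun x : ℝ => (d (2 * k)).eval x := by
      apply Polynomial.isBigO_atTop_of_degree_le
      rcases Nat.eq_zero_or_pos k with rfl | hpos
      · simp [hd.zero]
      · have h2 : d (2 * k) ≠ 0 := by
          intro h0
          have := hd.natDegree (2 * k) le_top
          rw [h0] at this
          simp at this
          omega
        rw [Polynomial.degree_eq_natDegree h2, hd.natDegree (2 * k) le_top]
        refine Polynomial.degree_le_of_natDegree_le (Polynomial.natDegree_pow_le.trans ?_)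
        rw [hd.natDegree k hk]
    obtain ⟨c, hc⟩ := (hO.comp_tendsto tendsto_natCast_atTop_atTop).bound
    obtain ⟨N, hN⟩ := eventually_atTop.1 hc
    refine ⟨1 + |c| + ∑ n ∈ Finset.range N, (d k).eval (n : ℝ) ^ 2, ?_, 2 * k, le_rfl, le_top, ?_⟩
    · have : 0 ≤ ∑ n ∈ Finset.range N, (d k).eval (n : ℝ) ^ 2 :=
        Finset.sum_nonneg fun _ _ => sq_nonneg _
      have := abs_nonneg c
      linarith
    · intro n hn
      have h0 := hd.nonneg (2 * k) n le_top hn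
      have hs : 0 ≤ ∑ n ∈ Finset.range N, (d k).eval (n : ℝ) ^ 2 :=
        Finset.sum_nonneg fun _ _ => sq_nonneg _
      have hc0 := abs_nonneg c
      rcases lt_or_ge n N with h | h
      · have := Finset.single_le_sum (f := fun n : ℕ => (d k).eval (n : ℝ) ^ 2)
          (fun _ _ => sq_nonneg _) (Finset.mem_range.2 h)
        nlinarith
      · have := hN n h
        simp only [Function.comp, Polynomial.eval_pow, Real.norm_eq_abs, abs_of_nonneg h0,
          abs_of_nonneg (sq_nonneg ((d k).eval (n : ℝ)))] at this
        have := mul_le_mul_of_nonneg_right (le_abs_self c) h0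
        nlinarith
  | coe α =>
    have hs : 0 ≤ ∑ n ∈ Finset.range (α + 1), (d k).eval (n : ℝ) ^ 2 :=
      Finset.sum_nonneg fun _ _ => sq_nonneg _
    refine ⟨1 + ∑ n ∈ Finset.range (α + 1), (d k).eval (n : ℝ) ^ 2, by linarith, 0,
      Nat.zero_le _, by simp, ?_⟩
    intro n hn
    have hn' : n < α + 1 := Nat.lt_succ_of_le (by exact_mod_cast hn)
    have := Finset.single_le_sum (f := fun n : ℕ => (d k).eval (n : ℝ) ^ 2)
      (fun _ _ => sq_nonneg _) (Finset.mem_range.2 hn')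
    simp only [hd.zero, Polynomial.eval_one]
    linarith

theorem dualityFun_eq_prod (h0 : d 0 = 1) (ξ : FinConfig G cap) {s : Finset G}
    (hs : ξ.1.support ⊆ s) (η : G → ℕ) :
    dualityFun d ξ η = ∏ x ∈ s, (d (ξ.1 x)).eval (η x : ℝ) :=
  Finsupp.prod_of_support_subset _ hs _ fun _ _ => by simp [h0]

theorem dualityFun_nonneg (hd : IsDualityPolynomials cap d) (ξ : FinConfig G cap) {η : G → ℕ}
    (hη : η ∈ configSpace G cap) : 0 ≤ dualityFun d ξ η :=
  Finset.prod_nonneg fun x _ => hd.nonneg _ _ (ξ.2 x) (hη x)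

theorem measurable_dualityFun (ξ : FinConfig G cap) : Measurable (dualityFun d ξ) := by
  unfold dualityFun Finsupp.prod
  refine Finset.measurable_prod _ fun x _ => ?_
  exact (Measurable.of_discrete (f := fun n : ℕ => (d (ξ.1 x)).eval (n : ℝ))).comp
    (measurable_pi_apply x)

theorem FinConfig.card_support_le (ξ : FinConfig G cap) : ξ.1.support.card ≤ ξ.size := by
  rw [FinConfig.size, Finsupp.degree_apply, Finset.card_eq_sum_ones]
  refine Finset.sum_le_sum fun x hx => ?_
  exact Nat.one_le_iff_ne_zero.2 (Finsupp.mem_support_iff.1 hx)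

theorem FinConfig.apply_le_size (ξ : FinConfig G cap) (x : G) : ξ.1 x ≤ ξ.size :=
  Finsupp.le_degree x ξ.1

/-- The union of two finite configurations with disjoint supports. -/
noncomputable def FinConfig.add (ξ ξ' : FinConfig G cap) (h : ξ.Perp ξ') : FinConfig G cap :=
  ⟨ξ.1 + ξ'.1, fun x => by
    by_cases hx : ξ.1 x = 0
    · simpa [hx] using ξ'.2 x
    · have : ξ'.1 x = 0 := Finsupp.notMem_support_iff.1
        (Finset.disjoint_left.1 h (Finsupp.mem_support_iff.2 hx))
      simpa [this] using ξ.2 x⟩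

theorem FinConfig.size_add (ξ ξ' : FinConfig G cap) (h : ξ.Perp ξ') :
    (ξ.add ξ' h).size = ξ.size + ξ'.size := by
  simp [FinConfig.size, FinConfig.add]

theorem dualityFun_add (ξ ξ' : FinConfig G cap) (h : ξ.Perp ξ') (η : G → ℕ) :
    dualityFun d (ξ.add ξ' h) η = dualityFun d ξ η * dualityFun d ξ' η := by
  classical
  exact Finsupp.prod_add_index_of_disjoint h _

/-- The configuration with `k` particles at `x` and none elsewhere. -/
noncomputable def FinConfig.single (x : G) (k : ℕ) (hk : (k : ℕ∞) ≤ cap) : FinConfig G cap :=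
  ⟨Finsupp.single x k, fun y => by
    classical
    rw [Finsupp.single_apply]
    split_ifs
    · exact hk
    · simp⟩

theorem FinConfig.size_single (x : G) (k : ℕ) (hk : (k : ℕ∞) ≤ cap) :
    (FinConfig.single x k hk).size = k := by
  simp [FinConfig.size, FinConfig.single]

theorem dualityFun_single (h0 : d 0 = 1) (x : G) (k : ℕ) (hk : (k : ℕ∞) ≤ cap) (η : G → ℕ) :
    dualityFun d (FinConfig.single x k hk) η = (d k).eval (η x : ℝ) :=
  Finsupp.prod_single_index (by simp [h0])

/-- The configuration with `g x` particles at the sites `x ∈ s` and none elsewhere. -/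
noncomputable def FinConfig.ofFinset (s : Finset G) (g : G → ℕ) (hg : ∀ x, (g x : ℕ∞) ≤ cap) :
    FinConfig G cap :=
  ⟨Finsupp.indicator s fun x _ => g x, fun x => by
    classical
    rw [Finsupp.indicator_apply]
    split_ifs
    · exact hg x
    · simp⟩

theorem FinConfig.ofFinset_apply {s : Finset G} (g : G → ℕ) (hg : ∀ x, (g x : ℕ∞) ≤ cap) {x : G}
    (hx : x ∈ s) : (FinConfig.ofFinset s g hg).1 x = g x :=
  Finsupp.indicator_of_mem hx fun y _ => g y

theorem FinConfig.support_ofFinset_subset (s : Finset G) (g : G → ℕ)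
    (hg : ∀ x, (g x : ℕ∞) ≤ cap) : (FinConfig.ofFinset s g hg).1.support ⊆ s :=
  Finsupp.support_indicator_subset s _

theorem FinConfig.size_ofFinset (s : Finset G) (g : G → ℕ) (hg : ∀ x, (g x : ℕ∞) ≤ cap) :
    (FinConfig.ofFinset s g hg).size = ∑ x ∈ s, g x := by
  rw [FinConfig.size, Finsupp.degree_apply,
    Finset.sum_subset (FinConfig.support_ofFinset_subset s g hg) fun x _ hx =>
      Finsupp.notMem_support_iff.1 hx]
  exact Finset.sum_congr rfl fun x hx => FinConfig.ofFinset_apply g hg hx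

theorem FinConfig.size_ofFinset_empty (g : G → ℕ) (hg : ∀ x, (g x : ℕ∞) ≤ cap) :
    (FinConfig.ofFinset ∅ g hg).size = 0 := by
  rw [FinConfig.size_ofFinset, Finset.sum_empty]

theorem dualityFun_ofFinset_empty (h0 : d 0 = 1) (g : G → ℕ) (hg : ∀ x, (g x : ℕ∞) ≤ cap)
    (η : G → ℕ) : dualityFun d (FinConfig.ofFinset ∅ g hg) η = 1 := by
  rw [dualityFun_eq_prod h0 _ (FinConfig.support_ofFinset_subset _ _ _), Finset.prod_empty]

theorem IsTempered.dTransform_ofFinset_empty {m : Measure (G → ℕ)} (h0 : d 0 = 1)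
    (hm : IsTempered d cap m) (g : G → ℕ) (hg : ∀ x, (g x : ℕ∞) ≤ cap) :
    dTransform d m (FinConfig.ofFinset ∅ g hg) = 1 := by
  have := hm.isProbabilityMeasure
  simp [dTransform, dualityFun_ofFinset_empty h0]

theorem FinConfig.exists_size_eq [Infinite G] (hcap : 1 ≤ cap) (n : ℕ) :
    ∃ ξ : FinConfig G cap, ξ.size = n := by
  obtain ⟨s, hs⟩ := Infinite.exists_subset_card_eq G n
  refine ⟨FinConfig.ofFinset s (fun _ => 1) fun _ => by exact_mod_cast hcap, ?_⟩
  rw [FinConfig.size_ofFinset, Finset.sum_const, smul_eq_mul, mul_one, hs]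

theorem FinConfig.size_eq_zero_of_cap (hcap : ¬ 1 ≤ cap) (ξ : FinConfig G cap) : ξ.size = 0 := by
  have hc : cap = 0 := by simpa [Order.one_le_iff_ne_zero] using hcap
  refine (Finsupp.degree_eq_zero_iff ξ.1).2 (Finsupp.ext fun x => ?_)
  have := ξ.2 x
  simp only [hc] at this
  simpa using this

/-- Multiplying the one-site bounds and expanding `∏ (1 + d e)` over subsets of the support bounds
`D(ξ, ·)²` by a sum of duality functions with at most `2 * n` particles, which temperedness controls
uniformly. -/
theorem IsTempered.memLp_dualityFun_and_integral_sq_le {m : Measure (G → ℕ)}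
    (hd : IsDualityPolynomials cap d) (hm : IsTempered d cap m) (n : ℕ) :
    ∃ K : ℝ, ∀ ξ : FinConfig G cap, ξ.size = n →
      MemLp (dualityFun d ξ) 2 m ∧ ∫ η, dualityFun d ξ η ^ 2 ∂m ≤ K := by
  classical
  -- Admissibility of `k` is moved inside, so that `e` is an admissible function of every natural
  -- number, as `FinConfig.ofFinset` requires.
  have hex : ∀ k : ℕ, ∃ C : ℝ, 1 ≤ C ∧ ∃ e : ℕ, e ≤ 2 * k ∧ (e : ℕ∞) ≤ cap ∧
      ((k : ℕ∞) ≤ cap → ∀ l : ℕ, (l : ℕ∞) ≤ cap →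
        (d k).eval (l : ℝ) ^ 2 ≤ C * (1 + (d e).eval (l : ℝ))) := by
    intro k
    by_cases hk : (k : ℕ∞) ≤ cap
    · obtain ⟨C, hC, e, he, he', h⟩ := hd.exists_sq_eval_le k hk
      exact ⟨C, hC, e, he, he', fun _ => h⟩
    · exact ⟨1, le_rfl, 0, Nat.zero_le _, by simp, fun h => absurd h hk⟩
  choose C hC e he he' hCe using hex
  obtain ⟨M, hM⟩ := hm.bounded (2 * n)
  set B : ℝ := ∑ k ∈ Finset.range (n + 1), C k with hB
  have hCB : ∀ k ≤ n, C k ≤ B := fun k hk =>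
    Finset.single_le_sum (f := C) (fun i _ => zero_le_one.trans (hC i))
      (Finset.mem_range.2 (Nat.lt_succ_of_le hk))
  have hB1 : 1 ≤ B := (hC 0).trans (hCB 0 (Nat.zero_le _))
  -- A configuration of `n` particles occupies at most `n` sites: one factor `B ≥ 1` per site, at
  -- most `2 ^ n` subsets, and a `D`-transform at most `|M|` for each.
  refine ⟨B ^ n * (2 ^ n * |M|), fun ξ hξ => ?_⟩
  let ζ : Finset G → FinConfig G cap := fun A =>
    FinConfig.ofFinset (A ∩ ξ.1.support) (fun x => e (ξ.1 x)) fun x => he' _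
  have hζsize : ∀ A, (ζ A).size ≤ 2 * n := by
    intro A
    rw [FinConfig.size_ofFinset, ← hξ, FinConfig.size, Finsupp.degree_apply, Finset.mul_sum]
    exact (Finset.sum_le_sum fun x _ => he _).trans
      (Finset.sum_le_sum_of_subset Finset.inter_subset_right)
  have hζM : ∀ A, ∫ η, dualityFun d (ζ A) η ∂m ≤ |M| := fun A =>
    (hM ⟨ζ A, hζsize A, rfl⟩).trans (le_abs_self M)
  have hpt : ∀ η ∈ configSpace G cap, dualityFun d ξ η ^ 2 ≤
      B ^ n * ∑ A ∈ ξ.1.support.powerset, dualityFun d (ζ A) η := by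
    intro η hη
    have h1 : dualityFun d ξ η ^ 2 ≤
        ∏ x ∈ ξ.1.support, (B * (1 + (d (e (ξ.1 x))).eval (η x : ℝ))) := by
      unfold dualityFun Finsupp.prod
      rw [← Finset.prod_pow]
      refine Finset.prod_le_prod (fun _ _ => sq_nonneg _) fun x _ => ?_
      refine (hCe _ (ξ.2 x) _ (hη x)).trans ?_
      refine mul_le_mul_of_nonneg_right (hCB _ (hξ ▸ ξ.apply_le_size x)) ?_
      have := hd.nonneg _ _ (he' (ξ.1 x)) (hη x)
      linarith
    refine h1.trans ?_
    rw [Finset.prod_mul_distrib, Finset.prod_const, Finset.prod_one_add]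
    have h2 : ∑ A ∈ ξ.1.support.powerset, ∏ x ∈ A, (d (e (ξ.1 x))).eval (η x : ℝ) =
        ∑ A ∈ ξ.1.support.powerset, dualityFun d (ζ A) η := by
      refine Finset.sum_congr rfl fun A hA => ?_
      have hA' : A ∩ ξ.1.support = A := Finset.inter_eq_left.2 (Finset.mem_powerset.1 hA)
      rw [dualityFun_eq_prod hd.zero (ζ A) (FinConfig.support_ofFinset_subset _ _ _), hA']
      refine Finset.prod_congr rfl fun x hx => ?_
      rw [FinConfig.ofFinset_apply _ _ (hA'.symm ▸ hx)]
    rw [h2]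
    refine mul_le_mul_of_nonneg_right (pow_le_pow_right₀ hB1 (hξ ▸ ξ.card_support_le)) ?_
    exact Finset.sum_nonneg fun A _ => dualityFun_nonneg hd _ hη
  have hdom : Integrable (fun η => B ^ n * ∑ A ∈ ξ.1.support.powerset, dualityFun d (ζ A) η) m :=
    (integrable_finsetSum _ fun A _ => hm.integrable (ζ A)).const_mul _
  have hsq : Integrable (fun η => dualityFun d ξ η ^ 2) m := by
    refine hdom.mono' ((measurable_dualityFun ξ).pow_const 2).aestronglyMeasurable ?_
    filter_upwards [hm.ae_mem] with η hη
    rw [Real.norm_eq_abs, abs_of_nonneg (sq_nonneg _)]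
    exact hpt η hη
  refine ⟨(memLp_two_iff_integrable_sq (measurable_dualityFun ξ).aestronglyMeasurable).2 hsq, ?_⟩
  refine (integral_mono_ae hsq hdom ?_).trans ?_
  · filter_upwards [hm.ae_mem] with η hη using hpt η hη
  · rw [integral_const_mul, integral_finsetSum _ fun A _ => hm.integrable (ζ A)]
    refine mul_le_mul_of_nonneg_left ?_ (by positivity)
    refine (Finset.sum_le_sum fun A _ => hζM A).trans ?_
    rw [Finset.sum_const, nsmul_eq_mul, Finset.card_powerset]
    refine mul_le_mul_of_nonneg_right ?_ (abs_nonneg M)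
    push_cast
    exact pow_le_pow_right₀ one_le_two (hξ ▸ ξ.card_support_le)

end DualityFunctions

end ParticleDuality

namespace ParticleDuality

/-! ### The `L²` operator of a kernel with an invariant measure. -/

section TransitionOperator

variable {S : Type u} [MeasurableSpace S] {μ : Measure S} [IsProbabilityMeasure μ]
  {κ : Kernel S S} [IsMarkovKernel κ]

theorem measurePreserving_fst_compProd :
    MeasurePreserving Prod.fst (μ ⊗ₘ κ) μ :=
  ⟨measurable_fst, Measure.fst_compProd μ κ⟩

theorem measurePreserving_snd_compProd (h : μ.bind κ = μ) :
    MeasurePreserving Prod.snd (μ ⊗ₘ κ) μ :=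
  ⟨measurable_snd, (Measure.snd_compProd μ κ).trans h⟩

/-- The operator on `L²(μ)` induced by a Markov kernel for which `μ` is invariant. -/
noncomputable def transitionOp (h : μ.bind κ = μ) : Lp ℝ 2 μ →L[ℝ] Lp ℝ 2 μ :=
  (ContinuousLinearMap.adjoint
    (Lp.compMeasurePreservingₗᵢ ℝ Prod.fst
      (measurePreserving_fst_compProd (μ := μ) (κ := κ))).toContinuousLinearMap).comp
    (Lp.compMeasurePreservingₗᵢ ℝ Prod.snd
      (measurePreserving_snd_compProd h)).toContinuousLinearMap

theorem norm_transitionOp_apply_le (h : μ.bind κ = μ) (g : Lp ℝ 2 μ) :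
    ‖transitionOp h g‖ ≤ ‖g‖ := by
  refine (ContinuousLinearMap.le_opNorm _ _).trans ?_
  refine mul_le_of_le_one_left (norm_nonneg _) ?_
  refine (ContinuousLinearMap.opNorm_comp_le _ _).trans ?_
  rw [LinearIsometryEquiv.norm_map]
  exact mul_le_one₀ (LinearIsometry.norm_toContinuousLinearMap_le _) (norm_nonneg _)
    (LinearIsometry.norm_toContinuousLinearMap_le _)

/-- `μ ⊗ₘ κ` is the law of the stationary pair (present, future), and `transitionOp` pulls back
along the future and projects onto the present. -/
theorem inner_transitionOp (h : μ.bind κ = μ) (f g : Lp ℝ 2 μ) :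
    inner ℝ f (transitionOp h g) = ∫ z, f z.1 * g z.2 ∂(μ ⊗ₘ κ) := by
  rw [transitionOp, ContinuousLinearMap.comp_apply, ContinuousLinearMap.adjoint_inner_right,
    L2.inner_def]
  refine integral_congr_ae ?_
  filter_upwards [Lp.coeFn_compMeasurePreserving f (measurePreserving_fst_compProd (κ := κ)),
    Lp.coeFn_compMeasurePreserving g (measurePreserving_snd_compProd h)] with z hf hg
  change inner ℝ ((Lp.compMeasurePreserving Prod.fst _ f) z)
    ((Lp.compMeasurePreserving Prod.snd _ g) z) = _
  rw [hf, hg]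
  simp [mul_comm]

theorem integrable_comp_snd_compProd (h : μ.bind κ = μ) {g : S → ℝ} (hg : Integrable g μ) :
    Integrable (fun z : S × S => g z.2) (μ ⊗ₘ κ) :=
  (measurePreserving_snd_compProd h).integrable_comp_of_integrable hg

theorem integrable_integral_kernel (h : μ.bind κ = μ) {g : S → ℝ} (hg : Integrable g μ) :
    Integrable (fun x => ∫ y, g y ∂(κ x)) μ := by
  have hz := integrable_comp_snd_compProd (κ := κ) h hg
  rw [Measure.compProd] at hz
  simpa using hz.integral_compProd

theorem coeFn_transitionOp (h : μ.bind κ = μ) (g : Lp ℝ 2 μ) :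
    transitionOp h g =ᵐ[μ] fun x => ∫ y, g y ∂(κ x) := by
  have hg : Integrable g μ := (Lp.memLp g).integrable one_le_two
  refine Integrable.ae_eq_of_forall_setIntegral_eq _ _
    ((Lp.memLp (transitionOp h g)).integrable one_le_two) (integrable_integral_kernel h hg) ?_
  intro A hA hμA
  rw [← L2.inner_indicatorConstLp_one (𝕜 := ℝ) hA hμA.ne, inner_transitionOp]
  have h1 : ∀ᵐ z ∂(μ ⊗ₘ κ), (indicatorConstLp 2 hA hμA.ne (1 : ℝ)) z.1 =
      A.indicator (fun _ => (1 : ℝ)) z.1 :=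
    measurePreserving_fst_compProd.quasiMeasurePreserving.ae indicatorConstLp_coeFn
  have h2 : ∫ z, (indicatorConstLp 2 hA hμA.ne (1 : ℝ)) z.1 * g z.2 ∂(μ ⊗ₘ κ) =
      ∫ z in A ×ˢ Set.univ, g z.2 ∂(μ ⊗ₘ κ) := by
    rw [← integral_indicator (hA.prod MeasurableSet.univ)]
    refine integral_congr_ae ?_
    filter_upwards [h1] with z hz
    rw [hz]
    by_cases hzA : z.1 ∈ A <;> simp [Set.indicator, hzA]
  rw [h2, Measure.setIntegral_compProd hA MeasurableSet.univ
    (integrable_comp_snd_compProd h hg).integrableOn]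
  simp

/-- By invariance a `μ`-null set is `κ x`-null for `μ`-almost every `x`, so the choice of
representative is harmless. -/
theorem coeFn_transitionOp_of_ae_eq (h : μ.bind κ = μ) {g : Lp ℝ 2 μ} {g' : S → ℝ}
    (hg : g =ᵐ[μ] g') : transitionOp h g =ᵐ[μ] fun x => ∫ y, g' y ∂(κ x) := by
  refine (coeFn_transitionOp h g).trans ?_
  have : ∀ᵐ y ∂(μ.bind κ), g y = g' y := by rw [h]; exact hg
  filter_upwards [Measure.ae_ae_of_ae_comp this] with x hx using integral_congr_ae hx

theorem transitionOp_comp {κ' κ'' : Kernel S S} [IsMarkovKernel κ'] [IsMarkovKernel κ'']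
    (h : μ.bind κ = μ) (h' : μ.bind κ' = μ) (h'' : μ.bind κ'' = μ) (hκ : κ'' = κ'.comp κ)
    (g : Lp ℝ 2 μ) : transitionOp h (transitionOp h' g) = transitionOp h'' g := by
  refine Lp.ext ?_
  refine (coeFn_transitionOp_of_ae_eq h (coeFn_transitionOp h' g)).trans ?_
  refine .trans ?_ (coeFn_transitionOp h'' g).symm
  have hg : Integrable g (μ.bind κ'') := by
    rw [h'']; exact (Lp.memLp g).integrable one_le_two
  filter_upwards [Measure.ae_integrable_of_integrable_comp hg] with x hx
  subst hκ
  exact (Kernel.integral_comp hx).symm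

end TransitionOperator

/-! ### Weak limits in Hilbert space. -/

section WeakLimits

variable {H : Type*} [NormedAddCommGroup H] [InnerProductSpace ℝ H] [CompleteSpace H]

/-- Banach–Alaoglu combined with the Riesz representation; an ultrafilter takes the place of a
subsequence, so separability is not needed. -/
theorem exists_tendsto_inner_of_norm_le {ι : Type*} (F : Ultrafilter ι) {w : ι → H} {C : ℝ}
    (hw : ∀ i, ‖w i‖ ≤ C) :
    ∃ g : H, ∀ h : H, Tendsto (fun i => (inner ℝ (w i) h : ℝ)) F (𝓝 (inner ℝ g h)) := by
  let φ : ι → WeakDual ℝ H := fun i =>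
    StrongDual.toWeakDual (InnerProductSpace.toDual ℝ H (w i))
  have hc := WeakDual.isCompact_closedBall (𝕜 := ℝ) (E := H) 0 C
  have hmem : ∀ i, φ i ∈ WeakDual.toStrongDual ⁻¹' Metric.closedBall (0 : StrongDual ℝ H) C := by
    intro i
    simp only [Set.mem_preimage, mem_closedBall_zero_iff]
    change ‖InnerProductSpace.toDual ℝ H (w i)‖ ≤ C
    rw [LinearIsometryEquiv.norm_map]
    exact hw i
  obtain ⟨ψ, -, hψ⟩ := hc.ultrafilter_le_nhds (F.map φ)
    (le_principal_iff.2 (Filter.mem_map.2 (univ_mem' hmem)))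
  refine ⟨(InnerProductSpace.toDual ℝ H).symm (WeakDual.toStrongDual ψ), fun h => ?_⟩
  rw [InnerProductSpace.toDual_symm_apply]
  exact ((WeakDual.eval_continuous h).tendsto ψ).comp hψ

/-- Bounded orbits of a contraction semigroup which converge weakly on a separating family have
an invariant weak limit. -/
theorem exists_invariant_weak_limit {ι : Type*} (T : ℝ≥0 → H →L[ℝ] H)
    (hT : ∀ s h, ‖T s h‖ ≤ ‖h‖) (hadd : ∀ s t h, T s (T t h) = T (s + t) h)
    (v : ι → H) (hv : ∀ a : H, (∀ i, inner ℝ a (v i) = (0 : ℝ)) → a = 0)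
    (u : H) (c : ι → ℝ) (hu : ∀ i, Tendsto (fun t => (inner ℝ (T t u) (v i) : ℝ)) atTop (𝓝 (c i))) :
    ∃ g : H, (∀ i, inner ℝ g (v i) = c i) ∧ ∀ s, T s g = g := by
  let F : Ultrafilter ℝ≥0 := Ultrafilter.of atTop
  have hF : (F : Filter ℝ≥0) ≤ atTop := Ultrafilter.of_le atTop
  obtain ⟨g, hg⟩ := exists_tendsto_inner_of_norm_le F (w := fun t => T t u) (fun t => hT t u)
  have hgc : ∀ i, inner ℝ g (v i) = c i := fun i =>
    tendsto_nhds_unique (hg (v i)) ((hu i).mono_left hF)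
  refine ⟨g, hgc, fun s => ?_⟩
  rw [← sub_eq_zero]
  refine hv _ fun i => ?_
  rw [inner_sub_left, hgc, sub_eq_zero]
  -- Testing against the adjoint image of `v i` shows that `T s g` is the weak limit of the
  -- time-shifted orbit, which has the same limits `c i`.
  have h1 := hg (ContinuousLinearMap.adjoint (T s) (v i))
  simp only [ContinuousLinearMap.adjoint_inner_right, hadd] at h1
  have h2 : Tendsto (fun t => (inner ℝ (T (s + t) u) (v i) : ℝ)) atTop (𝓝 (c i)) :=
    (hu i).comp (tendsto_atTop_mono (fun t => le_add_self) tendsto_id)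
  exact tendsto_nhds_unique h1 (h2.mono_left hF)

end WeakLimits

end ParticleDuality

namespace ParticleDuality

/-- Integrate the Markov property at time `0`, where the process sits at `x` almost surely. -/
theorem IsMarkovProcess.map_eq {S : Type u} [MeasurableSpace S] {P : MarkovSemigroup S}
    {W : Type v} [MeasurableSpace W] {Pr : Measure W} [IsProbabilityMeasure Pr]
    {Y : ℝ≥0 → W → S} {x : S} (hY : IsMarkovProcess P Pr Y x) (t : ℝ≥0) :
    Pr.map (Y t) = P.kernel t x := by
  have := P.isMarkovKernel t
  have := Measure.isProbabilityMeasure_map (μ := Pr) (hY.measurable t).aemeasurable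
  have hle : (⨆ r : ℝ≥0, ⨆ _ : r ≤ 0, MeasurableSpace.comap (Y r) inferInstance) ≤
      (inferInstance : MeasurableSpace W) :=
    iSup₂_le fun r _ => (hY.measurable r).comap_le
  refine Measure.ext fun A hA => ?_
  rw [← measureReal_eq_measureReal_iff, map_measureReal_apply (hY.measurable t) hA]
  have h1 := integral_congr_ae (hY.markov 0 t A hA)
  rw [integral_condExp hle, zero_add, integral_indicator (hY.measurable t hA)] at h1
  have h2 : ∫ w, (P.kernel t (Y 0 w)).real A ∂Pr = (P.kernel t x).real A := by
    rw [integral_congr_ae (g := fun _ => (P.kernel t x).real A)]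
    · simp
    · filter_upwards [hY.init] with w hw
      rw [hw]
  rw [h2] at h1
  simpa using h1

theorem exists_forall_eq_of_couplingTime_lt_top {S : Type u} {W : Type v} {Y Y' : ℝ≥0 → W → S}
    {w : W} (h : couplingTime Y Y' w < ∞) : ∃ T : ℝ≥0, ∀ t, T ≤ t → Y t w = Y' t w := by
  obtain ⟨_, ⟨T, hT, rfl⟩, -⟩ := sInf_lt_iff.1 h
  exact ⟨T, hT.2⟩

/-! ### Harmonicity of the `D`-transform and the coupling argument. -/

section Duality

variable {G : Type u} {cap : ℕ∞} {d : ℕ → ℝ[X]} {E : Set (G → ℕ)}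
  {P : MarkovSemigroup E} {Q : MarkovSemigroup (FinConfig G cap)} {μ : Measure E}

theorem measurable_dualityFun_coe (ξ : FinConfig G cap) :
    Measurable fun η : E => dualityFun d ξ (η : G → ℕ) :=
  (measurable_dualityFun ξ).comp measurable_subtype_coe

/-- Duality followed by Tonelli; countability of the dual state space supplies joint measurability,
and working in `[0, ∞]` avoids integrability conditions. -/
theorem IsDual.lintegral_mul_lintegral [Countable G] [SFinite μ] (hdual : IsDual d P Q) (t : ℝ≥0)
    (ξ : FinConfig G cap) {b : E → ℝ≥0∞} (hb : Measurable b) :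
    ∫⁻ η, b η * ∫⁻ η', ENNReal.ofReal (dualityFun d ξ (η' : G → ℕ)) ∂(P.kernel t η) ∂μ =
      ∫⁻ ζ, ∫⁻ η, b η * ENNReal.ofReal (dualityFun d ζ (η : G → ℕ)) ∂μ ∂(Q.kernel t ξ) := by
  have := Q.isMarkovKernel t
  have h : ∀ η : E, b η * ∫⁻ η', ENNReal.ofReal (dualityFun d ξ (η' : G → ℕ)) ∂(P.kernel t η) =
      ∫⁻ ζ, b η * ENNReal.ofReal (dualityFun d ζ (η : G → ℕ)) ∂(Q.kernel t ξ) := by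
    intro η
    rw [hdual t ξ η, lintegral_const_mul _ Measurable.of_discrete]
  simp_rw [h]
  refine lintegral_lintegral_swap (Measurable.aemeasurable ?_)
  exact measurable_from_prod_countable_left fun ζ =>
    hb.mul (measurable_dualityFun_coe ζ).ennreal_ofReal

theorem IsTempered.lintegral_dualityFun (hd : IsDualityPolynomials cap d)
    (hE : E ⊆ configSpace G cap) (hm : IsTempered d cap (μ.map ((↑) : E → G → ℕ)))
    (ξ : FinConfig G cap) :
    ∫⁻ η : E, ENNReal.ofReal (dualityFun d ξ (η : G → ℕ)) ∂μ =
      ENNReal.ofReal (dTransform d (μ.map ((↑) : E → G → ℕ)) ξ) := by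
  have h := (integrable_map_measure (measurable_dualityFun ξ).aestronglyMeasurable
    measurable_subtype_coe.aemeasurable).1 (hm.integrable ξ)
  rw [dTransform, integral_map measurable_subtype_coe.aemeasurable
    (measurable_dualityFun ξ).aestronglyMeasurable]
  exact (ofReal_integral_eq_lintegral_ofReal h
    (.of_forall fun η => dualityFun_nonneg hd ξ (hE η.2))).symm

theorem dTransform_nonneg (hd : IsDualityPolynomials cap d) {m : Measure (G → ℕ)}
    (hm : IsTempered d cap m) (ξ : FinConfig G cap) : 0 ≤ dTransform d m ξ :=
  integral_nonneg_of_ae (hm.ae_mem.mono fun _ hη => dualityFun_nonneg hd ξ hη)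

/-- The `D`-transform of an invariant measure is harmonic for the dual process. -/
theorem IsDual.lintegral_dTransform [Countable G] [SFinite μ] (hd : IsDualityPolynomials cap d)
    (hE : E ⊆ configSpace G cap) (hdual : IsDual d P Q) (hinv : P.IsInvariant μ)
    (hm : IsTempered d cap (μ.map ((↑) : E → G → ℕ))) (t : ℝ≥0) (ξ : FinConfig G cap) :
    ∫⁻ ζ, ENNReal.ofReal (dTransform d (μ.map ((↑) : E → G → ℕ)) ζ) ∂(Q.kernel t ξ) =
      ENNReal.ofReal (dTransform d (μ.map ((↑) : E → G → ℕ)) ξ) := by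
  simp_rw [← hm.lintegral_dualityFun hd hE]
  have h := hdual.lintegral_mul_lintegral (μ := μ) t ξ (b := fun _ => 1) measurable_const
  simp only [one_mul] at h
  rw [← h]
  conv_rhs => rw [← hinv.2 t]
  rw [Measure.lintegral_bind (P.kernel t).aemeasurable
    (measurable_dualityFun_coe ξ).ennreal_ofReal.aemeasurable]

/-- Harmonicity makes the expectation of the `D`-transform along each coupled copy constant in time,
while the difference of the two copies vanishes after the coupling time. -/
theorem dTransform_eq_of_size_eq [Countable G] [SFinite μ] (hd : IsDualityPolynomials cap d)
    (hE : E ⊆ configSpace G cap) (hdual : IsDual d P Q) (hcons : ConservesParticles Q)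
    (hcoup : HasSuccessfulCoupling.{u, v} Q) (hinv : P.IsInvariant μ)
    (hm : IsTempered d cap (μ.map ((↑) : E → G → ℕ))) {ξ ξ' : FinConfig G cap}
    (hξ : ξ.size = ξ'.size) :
    dTransform d (μ.map ((↑) : E → G → ℕ)) ξ = dTransform d (μ.map ((↑) : E → G → ℕ)) ξ' := by
  set F : FinConfig G cap → ℝ := dTransform d (μ.map ((↑) : E → G → ℕ)) with hF
  have hF0 : ∀ ζ, 0 ≤ F ζ := dTransform_nonneg hd hm
  obtain ⟨M, hM⟩ := hm.bounded ξ.size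
  obtain ⟨W, _, Pr, _, Y, Y', hY, hY', hc⟩ := hcoup ξ ξ' hξ
  -- The `D`-transform is bounded only for bounded particle number; truncating to one level gives a
  -- globally bounded function, and by conservation the expectations do not change.
  let g : FinConfig G cap → ℝ := fun ζ => if ζ.size = ξ.size then F ζ else 0
  have hg : ∀ ζ, ‖g ζ‖ ≤ |M| := by
    intro ζ
    by_cases h : ζ.size = ξ.size
    · simp only [g, if_pos h, Real.norm_eq_abs, abs_of_nonneg (hF0 ζ)]
      exact (hM ⟨ζ, h.le, rfl⟩).trans (le_abs_self M)
    · simp [g, h]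
  have hmean : ∀ (Z : ℝ≥0 → W → FinConfig G cap) (ζ : FinConfig G cap), ζ.size = ξ.size →
      IsMarkovProcess Q Pr Z ζ → ∀ t, ∫ w, g (Z t w) ∂Pr = F ζ := by
    intro Z ζ hζ hZ t
    rw [← integral_map (hZ.measurable t).aemeasurable
      (Measurable.of_discrete (f := g)).aestronglyMeasurable, hZ.map_eq t]
    rw [integral_congr_ae (g := F), integral_eq_lintegral_of_nonneg_ae (.of_forall hF0)
      Measurable.of_discrete.aestronglyMeasurable, hdual.lintegral_dTransform hd hE hinv hm t ζ,
      ENNReal.toReal_ofReal (hF0 ζ)]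
    filter_upwards [hcons t ζ] with ζ' hζ'
    simp [g, hζ', hζ]
  have hgm : ∀ (Z : ℝ≥0 → W → FinConfig G cap) (ζ : FinConfig G cap),
      IsMarkovProcess Q Pr Z ζ → ∀ t, Measurable fun w => g (Z t w) := fun Z ζ hZ t =>
    (Measurable.of_discrete (f := g)).comp (hZ.measurable t)
  have hgi : ∀ (Z : ℝ≥0 → W → FinConfig G cap) (ζ : FinConfig G cap),
      IsMarkovProcess Q Pr Z ζ → ∀ t, Integrable (fun w => g (Z t w)) Pr := fun Z ζ hZ t =>
    Integrable.of_bound (hgm Z ζ hZ t).aestronglyMeasurable |M| (.of_forall fun w => hg _)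
  have hlim : Tendsto (fun k : ℕ => ∫ w, (g (Y k w) - g (Y' k w)) ∂Pr) atTop
      (𝓝 (∫ _, (0 : ℝ) ∂Pr)) := by
    refine tendsto_integral_of_dominated_convergence (fun _ => |M| + |M|)
      (fun k => ((hgm Y ξ hY k).sub (hgm Y' ξ' hY' k)).aestronglyMeasurable)
      (integrable_const _) (fun k => .of_forall fun w => ?_) ?_
    · exact (norm_sub_le _ _).trans (add_le_add (hg _) (hg _))
    · filter_upwards [hc] with w hw
      obtain ⟨T, hT⟩ := exists_forall_eq_of_couplingTime_lt_top hw
      refine tendsto_const_nhds.congr' ?_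
      filter_upwards [(tendsto_natCast_atTop_atTop (R := ℝ≥0)).eventually_ge_atTop T] with k hk
      rw [hT _ hk, sub_self]
  have hconst : ∀ k : ℕ, ∫ w, (g (Y k w) - g (Y' k w)) ∂Pr = F ξ - F ξ' := by
    intro k
    rw [integral_sub (hgi Y ξ hY k) (hgi Y' ξ' hY' k), hmean Y ξ rfl hY, hmean Y' ξ' hξ.symm hY']
  simp only [hconst, integral_zero] at hlim
  exact sub_eq_zero.1 (tendsto_nhds_unique tendsto_const_nhds hlim)

/-! ### Duality functions in `L²(μ)` and asymptotic decorrelation. -/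

/-- The duality function `D(ξ, ·)` as an element of `L²(μ)`. -/
noncomputable def dualityLp (hd : IsDualityPolynomials cap d)
    (hm : IsTempered d cap (μ.map ((↑) : E → G → ℕ))) (ξ : FinConfig G cap) : Lp ℝ 2 μ :=
  MemLp.toLp (fun η : E => dualityFun d ξ (η : G → ℕ))
    (((hm.memLp_dualityFun_and_integral_sq_le hd ξ.size).choose_spec ξ rfl).1.comp_of_map
      measurable_subtype_coe.aemeasurable)

theorem coeFn_dualityLp (hd : IsDualityPolynomials cap d)
    (hm : IsTempered d cap (μ.map ((↑) : E → G → ℕ))) (ξ : FinConfig G cap) :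
    dualityLp hd hm ξ =ᵐ[μ] fun η : E => dualityFun d ξ (η : G → ℕ) :=
  MemLp.coeFn_toLp _

theorem eq_zero_of_inner_dualityLp_eq_zero (hd : IsDualityPolynomials cap d)
    (hm : IsTempered d cap (μ.map ((↑) : E → G → ℕ))) (a : Lp ℝ 2 μ)
    (ha : ∀ ξ, inner ℝ a (dualityLp hd hm ξ) = (0 : ℝ)) : a = 0 := by
  -- The σ-algebra of `E` is pulled back from the ambient space, so `a` factors through the
  -- inclusion and density can be used there; `E` itself need not be measurable.
  obtain ⟨h, hh, hah⟩ :=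
    (Lp.stronglyMeasurable a).measurable.exists_eq_measurable_comp (f := ((↑) : E → G → ℕ))
  have hcoe : Measurable ((↑) : E → G → ℕ) := measurable_subtype_coe
  have hL : MemLp h 2 (μ.map ((↑) : E → G → ℕ)) := by
    rw [memLp_map_measure_iff hh.aestronglyMeasurable hcoe.aemeasurable, ← hah]
    exact Lp.memLp a
  have hspan : ∀ k ∈ Submodule.span ℝ (Set.range fun ξ : FinConfig G cap => dualityFun d ξ),
      MemLp k 2 (μ.map ((↑) : E → G → ℕ)) ∧ ∫ η, h η * k η ∂(μ.map ((↑) : E → G → ℕ)) = 0 := by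
    intro k hk
    induction hk using Submodule.span_induction with
    | mem k hk =>
      obtain ⟨ξ, rfl⟩ := hk
      refine ⟨((hm.memLp_dualityFun_and_integral_sq_le hd ξ.size).choose_spec ξ rfl).1, ?_⟩
      have h1 := ha ξ
      rw [L2.inner_def] at h1
      refine (integral_map hcoe.aemeasurable
        (hh.mul (measurable_dualityFun ξ)).aestronglyMeasurable).trans (.trans ?_ h1)
      refine integral_congr_ae ?_
      filter_upwards [coeFn_dualityLp hd hm ξ] with η hη
      rw [hη, hah]
      simp [mul_comm]
    | zero => exact ⟨MemLp.zero, by simp⟩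
    | add k k' _ _ hk hk' =>
      refine ⟨hk.1.add hk'.1, ?_⟩
      simp only [Pi.add_apply, mul_add]
      refine (integral_add (hL.integrable_mul hk.1) (hL.integrable_mul hk'.1)).trans ?_
      exact (congrArg₂ (· + ·) hk.2 hk'.2).trans (add_zero 0)
    | smul c k _ hk =>
      refine ⟨hk.1.const_smul c, ?_⟩
      simp only [Pi.smul_apply, smul_eq_mul, mul_left_comm _ c]
      rw [integral_const_mul, hk.2, mul_zero]
  have horth : ∀ b : Lp ℝ 2 (μ.map ((↑) : E → G → ℕ)), inner ℝ (hL.toLp h) b = (0 : ℝ) := by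
    have hcl : IsClosed {b : Lp ℝ 2 (μ.map ((↑) : E → G → ℕ)) |
        inner ℝ (hL.toLp h) b = (0 : ℝ)} :=
      isClosed_eq (continuous_const.inner continuous_id) continuous_const
    intro b
    refine hcl.closure_subset_iff.2 ?_ (hm.dense b)
    rintro b ⟨k, hk, hbk⟩
    rw [Set.mem_ofPred_eq, L2.inner_def, ← (hspan k hk).2]
    refine integral_congr_ae ?_
    filter_upwards [hbk, hL.coeFn_toLp] with η h1 h2
    rw [h1, h2]
    simp [mul_comm]
  have h0 : hL.toLp h = 0 := inner_self_eq_zero.1 (horth _)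
  have h1 : h =ᵐ[μ.map ((↑) : E → G → ℕ)] 0 := hL.coeFn_toLp.symm.trans
    ((Lp.eq_zero_iff_ae_eq_zero).1 h0)
  rw [Lp.eq_zero_iff_ae_eq_zero, hah]
  exact ae_of_ae_map hcoe.aemeasurable h1

/-- From `a * b ≤ a ^ 2 + b ^ 2` and the second-moment bounds. Uniformity in `ζ` makes the
contribution of overlapping configurations negligible as the dual spreads out. -/
theorem exists_lintegral_mul_le (hd : IsDualityPolynomials cap d) (hE : E ⊆ configSpace G cap)
    (hm : IsTempered d cap (μ.map ((↑) : E → G → ℕ))) (ξ' : FinConfig G cap) (n : ℕ) :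
    ∃ K : ℝ≥0∞, K ≠ ∞ ∧ ∀ ζ : FinConfig G cap, ζ.size = n →
      ∫⁻ η : E, ENNReal.ofReal (dualityFun d ξ' (η : G → ℕ)) *
        ENNReal.ofReal (dualityFun d ζ (η : G → ℕ)) ∂μ ≤ K := by
  have hcoe : Measurable ((↑) : E → G → ℕ) := measurable_subtype_coe
  have key : ∀ n, ∃ K : ℝ, ∀ ζ : FinConfig G cap, ζ.size = n →
      ∫⁻ η : E, ENNReal.ofReal (dualityFun d ζ (η : G → ℕ) ^ 2) ∂μ ≤ ENNReal.ofReal K := by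
    intro n
    obtain ⟨K, hK⟩ := hm.memLp_dualityFun_and_integral_sq_le hd n
    refine ⟨K, fun ζ hζ => ?_⟩
    have h1 := (hK ζ hζ).1.integrable_sq
    rw [← lintegral_map (f := fun η => ENNReal.ofReal (dualityFun d ζ η ^ 2))
      ((measurable_dualityFun ζ).pow_const 2).ennreal_ofReal hcoe,
      ← ofReal_integral_eq_lintegral_ofReal h1 (.of_forall fun _ => sq_nonneg _)]
    exact ENNReal.ofReal_le_ofReal (hK ζ hζ).2
  obtain ⟨K, hK⟩ := key n
  obtain ⟨K', hK'⟩ := key ξ'.size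
  refine ⟨ENNReal.ofReal K' + ENNReal.ofReal K, by finiteness, fun ζ hζ => ?_⟩
  refine le_trans ?_ (add_le_add (hK' ξ' rfl) (hK ζ hζ))
  rw [← lintegral_add_left ((measurable_dualityFun_coe ξ').pow_const 2).ennreal_ofReal]
  refine lintegral_mono fun η => ?_
  have h1 := dualityFun_nonneg hd ξ' (hE η.2)
  rw [← ENNReal.ofReal_mul h1, ← ENNReal.ofReal_add (sq_nonneg _) (sq_nonneg _)]
  refine ENNReal.ofReal_le_ofReal ?_
  nlinarith [sq_nonneg (dualityFun d ξ' (η : G → ℕ) - dualityFun d ζ (η : G → ℕ)),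
    sq_nonneg (dualityFun d ξ' (η : G → ℕ)), sq_nonneg (dualityFun d ζ (η : G → ℕ))]

/-- Asymptotic decorrelation: if the dual process spreads out and the `D`-transform of `μ` depends
only on the number of particles, then `⟨S(t) D(ξ, ·), D(ξ', ·)⟩` converges. -/
theorem tendsto_inner_transitionOp_dualityLp [Countable G] [IsProbabilityMeasure μ]
    [∀ t, IsMarkovKernel (P.kernel t)]
    (hd : IsDualityPolynomials cap d)
    (hE : E ⊆ configSpace G cap) (hdual : IsDual d P Q) (hcons : ConservesParticles Q)
    (hinv : ∀ t, μ.bind (P.kernel t) = μ) (hspread : SpreadsOut Q)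
    (hm : IsTempered d cap (μ.map ((↑) : E → G → ℕ))) {f : ℕ → ℝ≥0}
    (hf : ∀ ξ : FinConfig G cap, dTransform d (μ.map ((↑) : E → G → ℕ)) ξ = f ξ.size)
    (ξ ξ' : FinConfig G cap) :
    Tendsto (fun t => (inner ℝ (transitionOp (hinv t) (dualityLp hd hm ξ))
      (dualityLp hd hm ξ') : ℝ)) atTop (𝓝 (f (ξ.size + ξ'.size))) := by
  let B : FinConfig G cap → ℝ≥0∞ := fun ζ => ∫⁻ η : E,
    ENNReal.ofReal (dualityFun d ξ' (η : G → ℕ)) * ENNReal.ofReal (dualityFun d ζ (η : G → ℕ)) ∂μ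
  let A : Set (FinConfig G cap) := {ζ | ζ.Perp ξ'}
  have hinner : ∀ t, (inner ℝ (transitionOp (hinv t) (dualityLp hd hm ξ))
      (dualityLp hd hm ξ') : ℝ) = (∫⁻ ζ, B ζ ∂(Q.kernel t ξ)).toReal := by
    intro t
    -- Both duality functions are non-negative on `E`, so the inner product is a Lebesgue integral
    -- in `[0, ∞]`, where duality and Tonelli apply directly.
    rw [real_inner_comm, inner_transitionOp, integral_congr_ae
      (g := fun z : E × E => dualityFun d ξ' (z.1 : G → ℕ) * dualityFun d ξ (z.2 : G → ℕ)),
      integral_eq_lintegral_of_nonneg_ae]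
    · have hprod : ∀ z : E × E,
          ENNReal.ofReal (dualityFun d ξ' (z.1 : G → ℕ) * dualityFun d ξ (z.2 : G → ℕ)) =
          ENNReal.ofReal (dualityFun d ξ' (z.1 : G → ℕ)) *
            ENNReal.ofReal (dualityFun d ξ (z.2 : G → ℕ)) := fun z =>
        ENNReal.ofReal_mul (dualityFun_nonneg hd ξ' (hE z.1.2))
      simp only [hprod]
      rw [Measure.lintegral_compProd (by
        exact ((measurable_dualityFun_coe ξ').comp measurable_fst).ennreal_ofReal.mul
          ((measurable_dualityFun_coe ξ).comp measurable_snd).ennreal_ofReal)]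
      rw [← hdual.lintegral_mul_lintegral (μ := μ) t ξ
        (measurable_dualityFun_coe ξ').ennreal_ofReal]
      congr 1
      refine lintegral_congr fun η => ?_
      simp only
      rw [lintegral_const_mul _ (measurable_dualityFun_coe ξ).ennreal_ofReal]
    · exact .of_forall fun z => mul_nonneg (dualityFun_nonneg hd ξ' (hE z.1.2))
        (dualityFun_nonneg hd ξ (hE z.2.2))
    · exact (((measurable_dualityFun_coe ξ').comp measurable_fst).mul
        ((measurable_dualityFun_coe ξ).comp measurable_snd)).aestronglyMeasurable
    · filter_upwards [measurePreserving_fst_compProd.quasiMeasurePreserving.ae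
        (coeFn_dualityLp hd hm ξ'), (measurePreserving_snd_compProd
        (hinv t)).quasiMeasurePreserving.ae (coeFn_dualityLp hd hm ξ)] with z h1 h2
      rw [h1, h2]
  obtain ⟨K, hK, hBK⟩ := exists_lintegral_mul_le (μ := μ) hd hE hm ξ' ξ.size
  -- On disjoint supports the product is the duality function of the union, whose transform depends
  -- only on the total number of particles.
  have hBA : ∀ ζ ∈ A, ζ.size = ξ.size → B ζ = f (ξ.size + ξ'.size) := by
    intro ζ hζ hs
    have h1 : ∀ η : E, ENNReal.ofReal (dualityFun d ξ' (η : G → ℕ)) *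
        ENNReal.ofReal (dualityFun d ζ (η : G → ℕ)) =
        ENNReal.ofReal (dualityFun d (ζ.add ξ' hζ) (η : G → ℕ)) := by
      intro η
      rw [dualityFun_add, ← ENNReal.ofReal_mul (dualityFun_nonneg hd ξ' (hE η.2)), mul_comm]
    simp only [B, h1]
    rw [hm.lintegral_dualityFun hd hE, hf, FinConfig.size_add, hs, ENNReal.ofReal_coe_nnreal]
  have hlim : Tendsto (fun t => ∫⁻ ζ, B ζ ∂(Q.kernel t ξ)) atTop
      (𝓝 (f (ξ.size + ξ'.size) : ℝ≥0∞)) := by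
    have hA : Tendsto (fun t => Q.kernel t ξ A) atTop (𝓝 1) := hspread ξ ξ'
    have hAc : Tendsto (fun t => Q.kernel t ξ Aᶜ) atTop (𝓝 0) := by
      have h1 : ∀ t, Q.kernel t ξ Aᶜ = 1 - Q.kernel t ξ A := fun t => by
        have := Q.isMarkovKernel t
        exact prob_compl_eq_one_sub (MeasurableSet.of_discrete)
      simp only [h1]
      simpa using ENNReal.Tendsto.sub tendsto_const_nhds hA (Or.inl ENNReal.one_ne_top)
    have hsplit : ∀ t, ∫⁻ ζ, B ζ ∂(Q.kernel t ξ) =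
        f (ξ.size + ξ'.size) * Q.kernel t ξ A + ∫⁻ ζ in Aᶜ, B ζ ∂(Q.kernel t ξ) := by
      intro t
      rw [← lintegral_add_compl B (MeasurableSet.of_discrete (s := A))]
      congr 1
      rw [← setLIntegral_const]
      refine setLIntegral_congr_fun_ae MeasurableSet.of_discrete ?_
      filter_upwards [hcons t ξ] with ζ hζ hζA using hBA ζ hζA hζ
    have hle : ∀ t, ∫⁻ ζ in Aᶜ, B ζ ∂(Q.kernel t ξ) ≤ K * Q.kernel t ξ Aᶜ := by
      intro t
      rw [← setLIntegral_const]
      refine lintegral_mono_ae (ae_restrict_of_ae ?_)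
      filter_upwards [hcons t ξ] with ζ hζ using hBK ζ hζ
    have h0 : Tendsto (fun t => ∫⁻ ζ in Aᶜ, B ζ ∂(Q.kernel t ξ)) atTop (𝓝 0) := by
      refine tendsto_of_tendsto_of_tendsto_of_le_of_le tendsto_const_nhds ?_
        (fun _ => zero_le) hle
      simpa using ENNReal.Tendsto.const_mul hAc (Or.inr hK)
    simp only [hsplit]
    simpa using (ENNReal.Tendsto.const_mul (a := (f (ξ.size + ξ'.size) : ℝ≥0∞)) hA
      (Or.inr ENNReal.coe_ne_top)).add h0
  simp only [hinner]
  exact (ENNReal.tendsto_toReal ENNReal.coe_ne_top).comp hlim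

theorem apply_size_add_of_isErgodic [Countable G] (hd : IsDualityPolynomials cap d)
    (hE : E ⊆ configSpace G cap) (hdual : IsDual d P Q) (hcons : ConservesParticles Q)
    (herg : P.IsErgodic μ) (hspread : SpreadsOut Q)
    (hm : IsTempered d cap (μ.map ((↑) : E → G → ℕ))) {f : ℕ → ℝ≥0}
    (hf : ∀ ξ : FinConfig G cap, dTransform d (μ.map ((↑) : E → G → ℕ)) ξ = f ξ.size)
    (ξ ξ' : FinConfig G cap) : f (ξ.size + ξ'.size) = f ξ.size * f ξ'.size := by
  have := herg.1.1
  have := P.isMarkovKernel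
  have hinv := herg.1.2
  obtain ⟨g, hg, hTg⟩ := exists_invariant_weak_limit (fun t => transitionOp (hinv t))
    (fun t => norm_transitionOp_apply_le (hinv t))
    (fun s t h => transitionOp_comp (hinv s) (hinv t) (hinv (s + t)) (P.add s t) h)
    (dualityLp hd hm) (eq_zero_of_inner_dualityLp_eq_zero hd hm) (dualityLp hd hm ξ)
    (fun ξ' => (f (ξ.size + ξ'.size) : ℝ))
    (tendsto_inner_transitionOp_dualityLp hd hE hdual hcons hinv hspread hm hf ξ)
  have hconst : (g : E → ℝ) =ᵐ[μ] fun _ => ∫ y, g y ∂μ := by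
    refine herg.2 g (Lp.memLp g) fun t => ?_
    refine (coeFn_transitionOp (hinv t) g).symm.trans ?_
    rw [hTg t]
  have hval : ∀ ζ : FinConfig G cap,
      (f (ξ.size + ζ.size) : ℝ) = (∫ y, g y ∂μ) * f ζ.size := by
    intro ζ
    rw [← hg ζ, L2.inner_def, ← hf ζ, dTransform,
      integral_map measurable_subtype_coe.aemeasurable
        (measurable_dualityFun ζ).aestronglyMeasurable, ← integral_const_mul]
    refine integral_congr_ae ?_
    filter_upwards [hconst, coeFn_dualityLp hd hm ζ] with η h1 h2
    rw [h2, h1]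
    simp [mul_comm]
  -- The empty configuration identifies the constant value of `g` as `f |ξ|`.
  have h1 := hval (FinConfig.ofFinset ∅ (fun _ => 0) fun _ => by simp)
  rw [← hf, hm.dTransform_ofFinset_empty hd.zero, FinConfig.size_ofFinset_empty, mul_one,
    add_zero] at h1
  have h2 := hval ξ'
  rw [← h1] at h2
  exact_mod_cast h2

/-- The one-site configurations give the moments `r ^ k` of every marginal; independence then gives
the product of the marginals the transform `r ^ |ξ|`, and temperedness says the transform determines
the measure. -/
theorem IsTempered.isProductMeasure [Countable G] (hd : IsDualityPolynomials cap d) {m : Measure (G → ℕ)}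
    (hm : IsTempered d cap m) {r : ℝ} (hr : ∀ ξ : FinConfig G cap, dTransform d m ξ = r ^ ξ.size) :
    IsProductMeasure m := by
  have := hm.isProbabilityMeasure
  have hev : ∀ x : G, Measurable fun η : G → ℕ => η x := measurable_pi_apply
  have hmarg : ∀ x : G, IsProbabilityMeasure (m.map fun η : G → ℕ => η x) := fun x =>
    Measure.isProbabilityMeasure_map (hev x).aemeasurable
  let p : G → ProbabilityMeasure ℕ := fun x => ⟨m.map fun η : G → ℕ => η x, hmarg x⟩
  let ν : Measure (G → ℕ) := Measure.infinitePi fun x => (p x : Measure ℕ)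
  have hint : ∀ (x : G) (k : ℕ), (k : ℕ∞) ≤ cap →
      Integrable (fun n : ℕ => (d k).eval (n : ℝ)) (p x : Measure ℕ) := by
    intro x k hk
    refine (integrable_map_measure Measurable.of_discrete.aestronglyMeasurable
      (hev x).aemeasurable).2 ?_
    have := hm.integrable (FinConfig.single x k hk)
    refine this.congr (.of_forall fun η => ?_)
    exact dualityFun_single hd.zero x k hk η
  have hval : ∀ (x : G) (k : ℕ), (k : ℕ∞) ≤ cap →
      ∫ n : ℕ, (d k).eval (n : ℝ) ∂(p x : Measure ℕ) = r ^ k := by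
    intro x k hk
    have h1 := hr (FinConfig.single x k hk)
    rw [FinConfig.size_single] at h1
    rw [← h1, dTransform]
    refine (integral_map (hev x).aemeasurable
      Measurable.of_discrete.aestronglyMeasurable).trans ?_
    exact integral_congr_ae (.of_forall fun η => (dualityFun_single hd.zero x k hk η).symm)
  have hres : ∀ ξ : FinConfig G cap, dualityFun d ξ = fun η : G → ℕ =>
      (fun y : ξ.1.support → ℕ => ∏ x : ξ.1.support, (d (ξ.1 x)).eval (y x : ℝ))
        (ξ.1.support.restrict η) := by
    intro ξ
    funext η
    exact (Finset.prod_coe_sort ξ.1.support fun x => (d (ξ.1 x)).eval (η x : ℝ)).symm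
  have hmeas : ∀ ξ : FinConfig G cap, Measurable
      fun y : ξ.1.support → ℕ => ∏ x : ξ.1.support, (d (ξ.1 x)).eval (y x : ℝ) := fun ξ =>
    Finset.measurable_prod _ fun x _ =>
      (Measurable.of_discrete (f := fun n : ℕ => (d (ξ.1 x)).eval (n : ℝ))).comp
        (measurable_pi_apply x)
  refine ⟨p, hm.determined ν inferInstance ?_ ?_ ?_⟩
  · refine ae_all_iff.2 fun x => ?_
    have h1 : ν.map (fun η : G → ℕ => η x) = m.map fun η : G → ℕ => η x :=
      Measure.infinitePi_map_eval (fun x => (p x : Measure ℕ)) x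
    refine ae_of_ae_map (p := fun k : ℕ => (k : ℕ∞) ≤ cap) (hev x).aemeasurable ?_
    rw [h1, ae_map_iff (hev x).aemeasurable MeasurableSet.of_discrete]
    exact hm.ae_mem.mono fun η hη => hη x
  · intro ξ
    rw [hres ξ]
    refine (integrable_map_measure (hmeas ξ).aestronglyMeasurable
      (Finset.measurable_restrict _).aemeasurable).1 ?_
    rw [Measure.infinitePi_map_restrict]
    exact Integrable.fintype_prod (f := fun (x : ξ.1.support) (n : ℕ) => (d (ξ.1 x)).eval (n : ℝ))
      fun x => hint x _ (ξ.2 x)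
  · intro ξ
    rw [hr ξ, dTransform, hres ξ, integral_restrict_infinitePi _ (hmeas ξ).aestronglyMeasurable,
      integral_fintype_prod_eq_prod
        (fun (x : ξ.1.support) (n : ℕ) => (d (ξ.1 x)).eval (n : ℝ))]
    simp only [fun x : ξ.1.support => hval x _ (ξ.2 x)]
    rw [Finset.prod_coe_sort ξ.1.support fun x => r ^ ξ.1 x, Finset.prod_pow_eq_pow_sum]
    rfl

end Duality

end ParticleDuality

theorem mainTheorem2 {G : Type u} [Countable G] [Infinite G]
    (cap : ℕ∞) (d : ℕ → ℝ[X]) (hd : IsDualityPolynomials cap d)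
    (E : Set (G → ℕ)) (hE : E ⊆ configSpace G cap)
    (P : MarkovSemigroup E) (Q : MarkovSemigroup (FinConfig G cap))
    (hdual : IsDual d P Q) (hcons : ConservesParticles Q)
    (hcoup : HasSuccessfulCoupling.{u, v} Q)
    (μ : Measure E) (hinv : P.IsInvariant μ)
    (htemp : IsTempered d cap (μ.map ((↑) : E → G → ℕ))) :
    ∃ f : ℕ → ℝ≥0,
      (∀ (n : ℕ) (ξ : FinConfig G cap), ξ.size = n →
        dTransform d (μ.map ((↑) : E → G → ℕ)) ξ = f n) ∧
      (P.IsErgodic μ → SpreadsOut Q →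
        (∀ n, f n = f 1 ^ n) ∧ IsProductMeasure (μ.map ((↑) : E → G → ℕ))) := by
  have hprob := hinv.1
  have hsize : ∀ {ξ ξ' : FinConfig G cap}, ξ.size = ξ'.size → _ :=
    dTransform_eq_of_size_eq hd hE hdual hcons hcoup hinv htemp
  classical
  -- The default `1` matters when `cap = 0`: only the empty configuration exists, and `f n = f 1 ^
  -- n` must still hold at the levels without configurations.
  let f : ℕ → ℝ≥0 := fun n => if h : ∃ ξ : FinConfig G cap, ξ.size = n then
    (dTransform d (μ.map ((↑) : E → G → ℕ)) h.choose).toNNReal else 1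
  have hf : ∀ ξ : FinConfig G cap, dTransform d (μ.map ((↑) : E → G → ℕ)) ξ = f ξ.size := by
    intro ξ
    have h : ∃ ξ' : FinConfig G cap, ξ'.size = ξ.size := ⟨ξ, rfl⟩
    simp only [f, dif_pos h]
    rw [hsize h.choose_spec, Real.coe_toNNReal _ (dTransform_nonneg hd htemp ξ)]
  refine ⟨f, fun n ξ hξ => hξ ▸ hf ξ, fun herg hspread => ?_⟩
  have hpow : ∀ n, f n = f 1 ^ n := by
    have hmul := apply_size_add_of_isErgodic hd hE hdual hcons herg hspread htemp hf
    have hf0 : f 0 = 1 := by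
      have h1 := hf (FinConfig.ofFinset ∅ (fun _ => 0) fun _ => by simp)
      rw [htemp.dTransform_ofFinset_empty hd.zero, FinConfig.size_ofFinset_empty] at h1
      exact_mod_cast h1.symm
    by_cases hcap : 1 ≤ cap
    · intro n
      induction n with
      | zero => rw [hf0, pow_zero]
      | succ n ih =>
        obtain ⟨ξ, hξ⟩ := FinConfig.exists_size_eq (G := G) hcap n
        obtain ⟨ξ', hξ'⟩ := FinConfig.exists_size_eq (G := G) hcap 1
        have := hmul ξ ξ'
        rw [hξ, hξ'] at this
        rw [this, ih, pow_succ]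
    · have hf1 : ∀ n, n ≠ 0 → f n = 1 := by
        intro n hn
        have h : ¬ ∃ ξ : FinConfig G cap, ξ.size = n := fun ⟨ξ, hξ⟩ =>
          hn (hξ ▸ FinConfig.size_eq_zero_of_cap hcap ξ)
        simp only [f, dif_neg h]
      intro n
      rw [hf1 1 one_ne_zero, one_pow]
      rcases eq_or_ne n 0 with rfl | hn
      · exact hf0
      · exact hf1 n hn
  refine ⟨hpow, htemp.isProductMeasure hd (r := f 1) fun ξ => ?_⟩
  rw [hf ξ, hpow ξ.size, NNReal.coe_pow]
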